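/- \textbf{The almost quantum set is supra-quantum.} Consider two parties, each with inputs in $\{0,1\}$ and outputs in $\{0,1\}$, and non-signalling distributions $P(a,b|x,y)$, where $x,a$ are the input and output of party 1 and $y,b$ those of party 2, viewed as points of $\mathbb R^{16}$. Write $P_1(a|x)=\sum_b P(a,b|x,y)$ and $P_2(b|y)=\sum_a P(a,b|x,y)$ for the marginals. A non-signalling distribution is determined by the vector $$\bar p=\big(P_1(1|0),P_1(1|1),P_2(1|0),P_2(1|1),P(1,1|0,0),P(1,1|1,0),P(1,1|0,1),P(1,1|1,1)\big).$$ \emph{Quantum set.} $P\in Q$ iff there are complex Hilbert spaces $\mathcal H_1,\mathcal H_2$ (of arbitrary dimension), a unit vector $\phi\in\mathcal H_1\otimes\mathcal H_2$ and orthogonal projections $E^{a,x}$ on $\mathcal H_1$ and $F^{b,y}$ on $\mathcal H_2$ with $\sum_aE^{a,x}=\mathbb I$ for all $x$, $\sum_bF^{b,y}=\mathbb I$ for all $y$, and $P(a,b|x,y)=\langle\phi|E^{a,x}\otimes F^{b,y}|\phi\rangle$. \emph{Almost quantum set.} $P\in\tilde Q$ iff there are a complex Hilbert space $\mathcal H$,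 a unit vector $\phi\in\mathcal H$ and orthogonal projections $E^{a,x},F^{b,y}$ on $\mathcal H$ with $\sum_aE^{a,x}=\sum_bF^{b,y}=\mathbb I$ for all $x,y$, with $E^{a,x}F^{b,y}\phi=F^{b,y}E^{a,x}\phi$ for all $a,b,x,y$, and with $P(a,b|x,y)=\langle\phi|E^{a,x}F^{b,y}|\phi\rangle$. \emph{Certificates.} An event assigns to each party either nothing or a pair (outcome $1$, input); the event in which no party measures is denoted $\emptyset$. This gives nine events, ordered as: $\emptyset$; $(1|0)$, $(1|1)$ of party 1; $(1|0)$, $(1|1)$ of party 2; $(1,1|0,0)$, $(1,1|1,0)$, $(1,1|0,1)$, $(1,1|1,1)$. An almost quantum certificate for $P$ is a real positive semidefinite matrix $\Gamma$ indexed by events such that $\Gamma_{\emptyset,\emptyset}=1$; $\Gamma_{\emptyset,e}=P(e)$ for all events $e$ (a marginal if only one party measures); $\Gamma_{e,f}=0$ whenever some party has the same input and different outcomes in $e$ and $f$; and $\Gamma_{e\cup f,e\cup g}=\Gamma_{f,e\cup g}=\Gamma_{e\cup f,g}$ whenever the parties measuring in $e$ measure neither in $f$ nor in $g$. Let $B(P)=\bar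 b\cdot\bar p$ with $$\bar b=\left(-\tfrac{30}{31},\tfrac{167}{9},\tfrac{167}{9},-\tfrac{30}{31},-\tfrac{174}{11},-\tfrac{244}{23},\tfrac{74}{11},-\tfrac{174}{11}\right),$$ let $P_{\tilde Q}$ be given by $$\bar p_{\tilde Q}=\left(\tfrac{9}{20},\tfrac{2}{11},\tfrac{2}{11},\tfrac{9}{20},\tfrac{22}{125},\tfrac{\sqrt2}{9},\tfrac{37}{700},\tfrac{22}{125}\right),$$ and let $$\Gamma=\begin{pmatrix} 1&\frac{9}{20}&\frac{2}{11}&\frac{2}{11}&\frac{9}{20}&\frac{22}{125}&\frac{\sqrt2}{9}&\frac{37}{700}&\frac{22}{125}\\ \frac{9}{20}&\frac{9}{20}&\frac{17}{155}&\frac{22}{125}&\frac{37}{700}&\frac{22}{125}&\frac{\sqrt{33}}{40}&\frac{37}{700}&\frac{\sqrt{71}}{100}\\ \frac{2}{11}&\frac{17}{155}&\frac{2}{11}&\frac{\sqrt2}{9}&\frac{22}{125}&\frac{\sqrt{33}}{40}&\frac{\sqrt2}{9}&\frac{\sqrt{71}}{100}&\frac{22}{125}\\ \frac{2}{11}&\frac{22}{125}&\frac{\sqrt2}{9}&\frac{2}{11}&\frac{17}{155}&\frac{22}{125}&\frac{\sqrt2}{9}&\frac{\sqrt{71}}{100}&\frac{\sqrt{33}}{40}\\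 \frac{9}{20}&\frac{37}{700}&\frac{22}{125}&\frac{17}{155}&\frac{9}{20}&\frac{\sqrt{71}}{100}&\frac{\sqrt{33}}{40}&\frac{37}{700}&\frac{22}{125}\\ \frac{22}{125}&\frac{22}{125}&\frac{\sqrt{33}}{40}&\frac{22}{125}&\frac{\sqrt{71}}{100}&\frac{22}{125}&\frac{\sqrt{33}}{40}&\frac{\sqrt{71}}{100}&\frac{21}{158}\\ \frac{\sqrt2}{9}&\frac{\sqrt{33}}{40}&\frac{\sqrt2}{9}&\frac{\sqrt2}{9}&\frac{\sqrt{33}}{40}&\frac{\sqrt{33}}{40}&\frac{\sqrt2}{9}&\frac{4}{53}&\frac{\sqrt{33}}{40}\\ \frac{37}{700}&\frac{37}{700}&\frac{\sqrt{71}}{100}&\frac{\sqrt{71}}{100}&\frac{37}{700}&\frac{\sqrt{71}}{100}&\frac{4}{53}&\frac{37}{700}&\frac{\sqrt{71}}{100}\\ \frac{22}{125}&\frac{\sqrt{71}}{100}&\frac{22}{125}&\frac{\sqrt{33}}{40}&\frac{22}{125}&\frac{21}{158}&\frac{\sqrt{33}}{40}&\frac{\sqrt{71}}{100}&\frac{22}{125}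 \end{pmatrix}.$$ Then: \begin{enumerate} \item $P_{\tilde Q}$ is a non-signalling distribution with vector $\bar p_{\tilde Q}$, the matrix $\Gamma$ is an almost quantum certificate for it, and $P_{\tilde Q}\in\tilde Q$. \item $|B(P_{\tilde Q})+1.0029|<5\cdot10^{-5}$; that is, $B(P_{\tilde Q})\approx-1.0029$. \item $B(P)>-1$ for every $P\in Q$. \item Hence $P_{\tilde Q}\notin\overline Q$, and $Q\subsetneq\tilde Q$ and $\overline Q\subsetneq\tilde Q$, where $\overline Q$ is the closure of $Q$. \end{enumerate} -/

import Mathlib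

open scoped TensorProduct

universe u

namespace AlmostQuantum

/-- A bipartite family `P a b x y = P(a,b|x,y)` with `m` inputs and `d` outputs per party:
`x`, `a` are the input and output of the first party, `y`, `b` those of the second. -/
abbrev Box (m d : ℕ) : Type := Fin d → Fin d → Fin m → Fin m → ℝ

/-- Non-signalling probability distributions. -/
structure IsNonSignalling {m d : ℕ} (P : Box m d) : Prop where
  nonneg : ∀ a b x y, 0 ≤ P a b x y
  sum_eq_one : ∀ x y, ∑ a, ∑ b, P a b x y = 1
  marginal_fst : ∀ a x y y', ∑ b, P a b x y = ∑ b, P a b x y'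
  marginal_snd : ∀ b y x x', ∑ a, P a b x y = ∑ a, P a b x' y

section Hilbert

variable {H : Type u} [NormedAddCommGroup H] [InnerProductSpace ℂ H] [CompleteSpace H]

/-- For every input a complete family of orthogonal projections, one for each output. -/
structure IsMeasurement {m d : ℕ} (E : Fin d → Fin m → H →L[ℂ] H) : Prop where
  projection : ∀ a x, IsStarProjection (E a x)
  complete : ∀ x, ∑ a, E a x = 1

end Hilbert

/-- The set of almost quantum bipartite distributions. -/
def almostQuantumSet (m d : ℕ) : Set (Box m d) :=
  {P | IsNonSignalling P ∧
    ∃ (H : Type u) (_ : NormedAddCommGroup H) (_ : InnerProductSpace ℂ H) (_ : CompleteSpace H)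
      (φ : H) (E F : Fin d → Fin m → H →L[ℂ] H),
      ‖φ‖ = 1 ∧ IsMeasurement E ∧ IsMeasurement F ∧
      (∀ a b x y, E a x (F b y φ) = F b y (E a x φ)) ∧
      ∀ a b x y, (P a b x y : ℂ) = inner ℂ φ (E a x (F b y φ))}

/-- The tensor product of Hilbert spaces: the completion of the algebraic tensor product with the
inner product determined by `⟪x ⊗ y, x' ⊗ y'⟫ = ⟪x, x'⟫ * ⟪y, y'⟫`. -/
abbrev HilbertTensor (H K : Type u) [NormedAddCommGroup H] [InnerProductSpace ℂ H]
    [NormedAddCommGroup K] [InnerProductSpace ℂ K] : Type u :=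
  UniformSpace.Completion (H ⊗[ℂ] K)

/-- The operator `S ⊗ T` on the tensor product of Hilbert spaces. -/
noncomputable def tensorOp {H K : Type u} [NormedAddCommGroup H] [InnerProductSpace ℂ H]
    [NormedAddCommGroup K] [InnerProductSpace ℂ K] (S : H →L[ℂ] H) (T : K →L[ℂ] K) :
    HilbertTensor H K →L[ℂ] HilbertTensor H K :=
  (TensorProduct.mapL S T).completion

/-- The set of quantum bipartite distributions (tensor product form, Hilbert spaces of arbitrary
dimension). -/
def quantumSet (m d : ℕ) : Set (Box m d) :=
  {P | IsNonSignalling P ∧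
    ∃ (H : Type u) (_ : NormedAddCommGroup H) (_ : InnerProductSpace ℂ H) (_ : CompleteSpace H)
      (K : Type u) (_ : NormedAddCommGroup K) (_ : InnerProductSpace ℂ K) (_ : CompleteSpace K)
      (φ : HilbertTensor H K) (E : Fin d → Fin m → H →L[ℂ] H) (F : Fin d → Fin m → K →L[ℂ] K),
      ‖φ‖ = 1 ∧ IsMeasurement E ∧ IsMeasurement F ∧
      ∀ a b x y, (P a b x y : ℂ) = inner ℂ φ (tensorOp (E a x) (F b y) φ)}

/-- What one party does in an event: nothing (`none`), or measure `x` and obtain a nonzero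
outcome `a` (`some (x, a)`). -/
abbrev LocalEvent (m d : ℕ) : Type := Option (Fin m × {a : Fin d // a.val ≠ 0})

/-- Bipartite events with nonzero outcomes; `(none, none)` is the null event. -/
abbrev Event (m d : ℕ) : Type := LocalEvent m d × LocalEvent m d

/-- Some common party has the same input and different outcomes in the two events. -/
def LocallyOrthogonal {m d : ℕ} (e f : Event m d) : Prop :=
  (∃ x a a', e.1 = some (x, a) ∧ f.1 = some (x, a') ∧ a ≠ a') ∨
  (∃ y b b', e.2 = some (y, b) ∧ f.2 = some (y, b') ∧ b ≠ b')

/-- No party measures in both events. -/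
def DisjointParties {m d : ℕ} (e f : Event m d) : Prop :=
  (e.1 = none ∨ f.1 = none) ∧ (e.2 = none ∨ f.2 = none)

/-- The union of two events with disjoint sets of measuring parties. -/
def joinEvent {m d : ℕ} (e f : Event m d) : Event m d :=
  (e.1.or f.1, e.2.or f.2)

/-- `Γ` is an almost quantum certificate for `P`. -/
structure IsCertificate {m d : ℕ} (P : Box m d) (Γ : Matrix (Event m d) (Event m d) ℝ) :
    Prop where
  posSemidef : Γ.PosSemidef
  orthogonal : ∀ e f, LocallyOrthogonal e f → Γ e f = 0
  null_null : Γ (none, none) (none, none) = 1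
  prob_fst : ∀ x a y, Γ (none, none) (some (x, a), none) = ∑ b, P a.1 b x y
  prob_snd : ∀ y b x, Γ (none, none) (none, some (y, b)) = ∑ a, P a b.1 x y
  prob_both : ∀ x a y b, Γ (none, none) (some (x, a), some (y, b)) = P a.1 b.1 x y
  consistent : ∀ e f g, DisjointParties e f → DisjointParties e g →
    Γ (joinEvent e f) (joinEvent e g) = Γ f (joinEvent e g) ∧
    Γ (joinEvent e f) (joinEvent e g) = Γ (joinEvent e f) g

/-! ### Two inputs and two outputs -/

/-- `(P₁(1|0), P₁(1|1), P₂(1|0), P₂(1|1), P(1,1|0,0), P(1,1|1,0), P(1,1|0,1), P(1,1|1,1))`. -/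
def toVector (P : Box 2 2) : Fin 8 → ℝ :=
  ![∑ b, P 1 b 0 0, ∑ b, P 1 b 1 0, ∑ a, P a 1 0 0, ∑ a, P a 1 0 1,
    P 1 1 0 0, P 1 1 1 0, P 1 1 0 1, P 1 1 1 1]

/-- The family of numbers obtained from an 8-dimensional vector by normalization and no-signalling:
the matrix in the last line is indexed by the outputs `a`, `b`. -/
def ofVector (p : Fin 8 → ℝ) : Box 2 2 := fun a b x y =>
  let pA : ℝ := ![p 0, p 1] x
  let pB : ℝ := ![p 2, p 3] y
  let pAB : ℝ := !![p 4, p 6; p 5, p 7] x y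
  !![1 - pA - pB + pAB, pB - pAB; pA - pAB, pAB] a b

/-- A non-signalling distribution is determined by its 8-dimensional vector. -/
theorem ofVector_toVector {P : Box 2 2} (hP : IsNonSignalling P) :
    ofVector (toVector P) = P := by
  have h1 := hP.sum_eq_one
  have h2 := hP.marginal_fst
  have h3 := hP.marginal_snd
  simp only [Fin.forall_fin_two, Fin.sum_univ_two] at h1 h2 h3
  funext a b x y
  fin_cases a <;> fin_cases b <;> fin_cases x <;> fin_cases y <;>
    simp [ofVector, toVector] <;> linarith

/-- The coefficients of the Bell functional. -/
noncomputable def bellVector : Fin 8 → ℝ :=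
  ![-(30 / 31), 167 / 9, 167 / 9, -(30 / 31), -(174 / 11), -(244 / 23), 74 / 11, -(174 / 11)]

/-- The Bell functional. -/
noncomputable def bell (P : Box 2 2) : ℝ := bellVector ⬝ᵥ toVector P

/-- The vector of the explicit almost quantum distribution. -/
noncomputable def explicitVector : Fin 8 → ℝ :=
  ![9 / 20, 2 / 11, 2 / 11, 9 / 20, 22 / 125, √2 / 9, 37 / 700, 22 / 125]

/-- The explicit almost quantum distribution. -/
noncomputable def explicitBox : Box 2 2 := ofVector explicitVector

/-- The explicit certificate. Rows and columns are ordered as: the null event, `(1|0)` and `(1|1)`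
for the first party, `(1|0)` and `(1|1)` for the second party, then `(1,1|0,0)`, `(1,1|1,0)`,
`(1,1|0,1)`, `(1,1|1,1)`. -/
noncomputable def explicitMatrix : Matrix (Fin 9) (Fin 9) ℝ :=
  !![1, 9/20, 2/11, 2/11, 9/20, 22/125, √2/9, 37/700, 22/125;
    9/20, 9/20, 17/155, 22/125, 37/700, 22/125, √33/40, 37/700, √71/100;
    2/11, 17/155, 2/11, √2/9, 22/125, √33/40, √2/9, √71/100, 22/125;
    2/11, 22/125, √2/9, 2/11, 17/155, 22/125, √2/9, √71/100, √33/40;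
    9/20, 37/700, 22/125, 17/155, 9/20, √71/100, √33/40, 37/700, 22/125;
    22/125, 22/125, √33/40, 22/125, √71/100, 22/125, √33/40, √71/100, 21/158;
    √2/9, √33/40, √2/9, √2/9, √33/40, √33/40, √2/9, 4/53, √33/40;
    37/700, 37/700, √71/100, √71/100, 37/700, √71/100, 4/53, 37/700, √71/100;
    22/125, √71/100, 22/125, √33/40, 22/125, 21/158, √33/40, √71/100, 22/125]

/-- The position of an event in the ordering used for `explicitMatrix`. -/
def eventIndex : Event 2 2 → Fin 9
  | (none, none) => 0
  | (some (x, _), none) => ![1, 2] x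
  | (none, some (y, _)) => ![3, 4] y
  | (some (x, _), some (y, _)) => !![5, 7; 6, 8] x y

end AlmostQuantum

/-!
Membership in the almost quantum set amounts to the existence of a positive semidefinite matrix,
while on the quantum set a sum of squares bounds the Bell functional from below; the explicit
distribution has a matrix of the first kind and violates the bound.

*Certificates.* For binary outcomes a non-signalling `P` is almost quantum if and only if it has a
certificate (`mem_almostQuantumSet_iff`). From operators `E`, `F` and a vector `φ` one obtains `Γ`
as the real part of the Gram matrix of the vectors `E F φ` of the events (`exists_isCertificate`).
Conversely, let `Γ` be the Gram matrix of vectors `v e`, and project onto the span of the `v e`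
over all events `e` in which the given party measures the given input. The consistency equations
say that this projection maps `v (none, g)` to `v (some (x, 1), g)`, so the projections of the two
parties commute on `φ = v (none, none)` (`IsCertificate.mem_almostQuantumSet`). The entries of a
certificate are bounded by one, so the pairs of a distribution and a certificate form a compact set,
and its projection, the almost quantum set, is closed (`isClosed_almostQuantumSet`).

*The explicit certificate.* Its smallest eigenvalue is about `2 * 10⁻⁴`, so it is enough to compare
it entrywise with `L * Lᵀ + δ • 1` for a rational matrix `L` (`posSemidef_of_abs_sub_le`).

*The bound on the quantum set.* A quantum distribution is given by projections `A₀, A₁` and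
`B₀, B₁` that commute as operators, not just on `φ`. Writing `y w` for the real part of
`⟪φ, w φ⟫`, where `w` is a nonempty product of the projections, there are a positive rational `δ` and
coefficients `r w` with
`B(P) + 1 = δ + ∑ₖ ‖sₖ φ‖² + ∑ w, r w * y w` and `∑ w, |r w| < δ`,
where the `sₖ` are eleven rational linear combinations of products of the projections, some of them
with two different projections of the same party. As `|y w| ≤ 1`, this gives `B(P) > -1`
(`neg_one_lt_of_commute`). The identity holds on all Hilbert spaces, so no reduction to finite
dimension is needed.

The functional is continuous, so it is at least `-1` on the closure of the quantum set, but about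
`-1.0029` at the explicit almost quantum distribution.
-/

namespace AlmostQuantum

/-! ### Positive semidefinite matrices -/

theorem posSemidef_re_inner {ι H : Type*} [Fintype ι] [NormedAddCommGroup H]
    [InnerProductSpace ℂ H] (v : ι → H) :
    (Matrix.of fun i j => (inner ℂ (v i) (v j)).re).PosSemidef := by
  let := InnerProductSpace.rclikeToReal ℂ H
  exact Matrix.posSemidef_gram ℝ v

/-- A symmetric matrix that is entrywise within `ε` of `L * Lᵀ + δ • 1` is positive semidefinite if
`δ` is at least `ε` times the size: the error `R` satisfies `|x ⬝ᵥ R x| ≤ card ι * ε * (x ⬝ᵥ x)`. -/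
theorem posSemidef_of_abs_sub_le {ι κ : Type*} [Fintype ι] [Fintype κ] [DecidableEq ι]
    {M : Matrix ι ι ℝ}
    (hM : M.IsHermitian) (L : Matrix ι κ ℝ) {ε δ : ℝ} (hδ : Fintype.card ι * ε ≤ δ)
    (h : ∀ i j, |M i j - (L * L.transpose + δ • (1 : Matrix ι ι ℝ)) i j| ≤ ε) : M.PosSemidef := by
  refine Matrix.PosSemidef.of_dotProduct_mulVec_nonneg hM fun x => ?_
  set R : Matrix ι ι ℝ := M - (L * L.transpose + δ • (1 : Matrix ι ι ℝ)) with hR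
  have hMR : M = L * L.transpose + δ • (1 : Matrix ι ι ℝ) + R := by rw [hR]; abel
  have hL : 0 ≤ x ⬝ᵥ (L * L.transpose).mulVec x :=
    (Matrix.posSemidef_self_mul_conjTranspose L).dotProduct_mulVec_nonneg x
  have hb : -(Fintype.card ι * ε * (x ⬝ᵥ x)) ≤ x ⬝ᵥ R.mulVec x := by
    -- AM-GM for each pair of coordinates, then summed over all pairs.
    have key : ∀ i j, -(ε * ((x i ^ 2 + x j ^ 2) / 2)) ≤ x i * (R i j * x j) := by
      intro i j
      have h1 : |x i * (R i j * x j)| ≤ ε * ((x i ^ 2 + x j ^ 2) / 2) := by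
        rw [show x i * (R i j * x j) = R i j * (x i * x j) by ring, abs_mul]
        have h2 : |x i * x j| ≤ (x i ^ 2 + x j ^ 2) / 2 := by
          rw [abs_le]
          constructor <;> nlinarith [sq_nonneg (x i - x j), sq_nonneg (x i + x j)]
        exact mul_le_mul (h i j) h2 (abs_nonneg _) ((abs_nonneg _).trans (h i j))
      linarith [neg_abs_le (x i * (R i j * x j))]
    calc -(Fintype.card ι * ε * (x ⬝ᵥ x)) = ∑ i, ∑ j, -(ε * ((x i ^ 2 + x j ^ 2) / 2)) := by
          simp only [dotProduct, Finset.sum_neg_distrib, ← Finset.mul_sum, ← Finset.sum_div,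
            Finset.sum_add_distrib, Finset.sum_const, Finset.card_univ, nsmul_eq_mul, ← pow_two]
          ring
      _ ≤ ∑ i, ∑ j, x i * (R i j * x j) :=
          Finset.sum_le_sum fun i _ => Finset.sum_le_sum fun j _ => key i j
      _ = x ⬝ᵥ R.mulVec x := by simp [dotProduct, Matrix.mulVec, Finset.mul_sum]
  have hx : 0 ≤ x ⬝ᵥ x := Finset.sum_nonneg fun i _ => mul_self_nonneg (x i)
  have hd : Fintype.card ι * ε * (x ⬝ᵥ x) ≤ δ * (x ⬝ᵥ x) := mul_le_mul_of_nonneg_right hδ hx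
  rw [star_trivial, hMR, Matrix.add_mulVec, Matrix.add_mulVec, dotProduct_add, dotProduct_add,
    Matrix.smul_mulVec, Matrix.one_mulVec, dotProduct_smul, smul_eq_mul]
  linarith

/-! ### The explicit certificate is positive semidefinite -/

theorem sqrt_bounds_of_sq {x l u : ℝ} (hu : 0 ≤ u) (h1 : l ^ 2 ≤ x) (h2 : x ≤ u ^ 2) :
    l ≤ √x ∧ √x ≤ u :=
  ⟨Real.le_sqrt_of_sq_le h1, Real.sqrt_le_iff.2 ⟨hu, h2⟩⟩

theorem sqrt_two_bounds : (1.414213 : ℝ) ≤ √2 ∧ √2 ≤ 1.414214 :=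
  sqrt_bounds_of_sq (by norm_num) (by norm_num) (by norm_num)

theorem sqrt_thirtyThree_bounds : (5.744562 : ℝ) ≤ √33 ∧ √33 ≤ 5.744563 :=
  sqrt_bounds_of_sq (by norm_num) (by norm_num) (by norm_num)

theorem sqrt_seventyOne_bounds : (8.426149 : ℝ) ≤ √71 ∧ √71 ≤ 8.42615 :=
  sqrt_bounds_of_sq (by norm_num) (by norm_num) (by norm_num)

/-- A rational approximation of the Cholesky factor of `explicitMatrix - (1 / 10000) • 1`. -/
noncomputable def explicitFactor : Matrix (Fin 9) (Fin 9) ℝ :=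
  (1 / 100000 : ℝ) • !![99995, 0, 0, 0, 0, 0, 0, 0, 0;
    45002, 49737, 0, 0, 0, 0, 0, 0, 0;
    18183, 5600, 38147, 0, 0, 0, 0, 0, 0;
    18183, 18934, 29746, 15597, 0, 0, 0, 0, 0;
    45002, -30091, 29104, -1119, 26834, 0, 0, 0, 0;
    17601, 19461, 26401, 18348, -4163, 4414, 0, 0, 0;
    15714, 14656, 31550, 4465, 9568, -162, 1298, 0, 0;
    5286, 5845, 18711, 5082, -2695, 8468, 94, 3251, 0;
    17601, 1016, 37598, -1380, -3626, 3878, -67, 1396, 1576]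

theorem explicitMatrix_isHermitian : explicitMatrix.IsHermitian := by
  ext i j
  fin_cases i <;> fin_cases j <;> rfl

set_option maxHeartbeats 1000000 in
theorem explicitMatrix_posSemidef : explicitMatrix.PosSemidef := by
  obtain ⟨h2, h2'⟩ := sqrt_two_bounds
  obtain ⟨h33, h33'⟩ := sqrt_thirtyThree_bounds
  obtain ⟨h71, h71'⟩ := sqrt_seventyOne_bounds
  -- The rounding errors of the factor amount to less than `10⁻⁵`, and `9 * 10⁻⁵ ≤ 10⁻⁴`.
  refine posSemidef_of_abs_sub_le explicitMatrix_isHermitian explicitFactor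
    (ε := 1 / 100000) (δ := 1 / 10000) (by norm_num) fun i j => ?_
  rw [abs_le, Matrix.add_apply, Matrix.smul_apply, Matrix.mul_apply]
  simp only [Matrix.transpose_apply, explicitFactor, Matrix.smul_apply, smul_eq_mul]
  fin_cases i <;> fin_cases j <;>
    simp [explicitMatrix, Fin.sum_univ_succ] <;>
    constructor <;> linarith

/-! ### Hilbert space operators and almost quantum certificates -/

section Operators

variable {H : Type*} [NormedAddCommGroup H] [InnerProductSpace ℂ H] [CompleteSpace H]

theorem inner_apply_left_of_isStarProjection {p : H →L[ℂ] H} (hp : IsStarProjection p) (v w : H) :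
    inner ℂ (p v) w = inner ℂ v (p w) := by
  have h := ContinuousLinearMap.adjoint_inner_left p w v
  rwa [← ContinuousLinearMap.star_eq_adjoint, hp.isSelfAdjoint.star_eq] at h

theorem apply_apply_of_isStarProjection {p : H →L[ℂ] H} (hp : IsStarProjection p) (v : H) :
    p (p v) = p v :=
  congr($(hp.isIdempotentElem.eq) v)

theorem norm_apply_le_of_isStarProjection {p : H →L[ℂ] H} (hp : IsStarProjection p) (v : H) :
    ‖p v‖ ≤ ‖v‖ := by
  simpa using p.le_of_opNorm_le hp.norm_le v

variable {m d : ℕ}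

/-- The operator of a local event: the identity if the party does not measure. -/
def localOp (E : Fin d → Fin m → H →L[ℂ] H) : LocalEvent m d → H →L[ℂ] H
  | none => 1
  | some (x, a) => E a.1 x

theorem IsMeasurement.isStarProjection_localOp {E : Fin d → Fin m → H →L[ℂ] H}
    (hE : IsMeasurement E) (s : LocalEvent m d) : IsStarProjection (localOp E s) := by
  rcases s with _ | ⟨x, a⟩
  · exact ⟨one_mul 1, star_one _⟩
  · exact hE.projection a.1 x

theorem IsMeasurement.sum_apply {E : Fin d → Fin m → H →L[ℂ] H}
    (hE : IsMeasurement E) (x : Fin m) (v : H) : ∑ a, E a x v = v := by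
  rw [← _root_.sum_apply, hE.complete x, one_apply_eq_self]

/-- The vector `E F φ` of an event, where `E` and `F` are the operators of its two local events. -/
def eventVector (φ : H) (E F : Fin d → Fin m → H →L[ℂ] H) (e : Event m d) : H :=
  localOp E e.1 (localOp F e.2 φ)

/-- The vectors of events satisfy the consistency equations of a certificate. Commutation of the
two parties is needed on `φ` only. -/
theorem inner_eventVector_joinEvent {φ : H} {E F : Fin d → Fin m → H →L[ℂ] H} (hE : IsMeasurement E)
    (hF : IsMeasurement F) (hc : ∀ a b x y, E a x (F b y φ) = F b y (E a x φ))
    {e f g : Event m d} (hf : DisjointParties e f) (hg : DisjointParties e g) :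
    inner ℂ (eventVector φ E F (joinEvent e f)) (eventVector φ E F (joinEvent e g)) =
      inner ℂ (eventVector φ E F f) (eventVector φ E F (joinEvent e g)) ∧
    inner ℂ (eventVector φ E F (joinEvent e f)) (eventVector φ E F (joinEvent e g)) =
      inner ℂ (eventVector φ E F (joinEvent e f)) (eventVector φ E F g) := by
  have hc' : ∀ s t, localOp E s (localOp F t φ) = localOp F t (localOp E s φ) := by
    rintro (_ | ⟨x, a⟩) (_ | ⟨y, b⟩) <;> simp [localOp, hc]
  have hES s := inner_apply_left_of_isStarProjection (hE.isStarProjection_localOp s)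
  have hFS s := inner_apply_left_of_isStarProjection (hF.isStarProjection_localOp s)
  have hEE s := apply_apply_of_isStarProjection (hE.isStarProjection_localOp s)
  have hFF s := apply_apply_of_isStarProjection (hF.isStarProjection_localOp s)
  have h1 (v : H) : localOp E none v = v := rfl
  have h2 (v : H) : localOp F none v = v := rfl
  obtain ⟨e1, e2⟩ := e
  obtain ⟨f1, f2⟩ := f
  obtain ⟨g1, g2⟩ := g
  obtain ⟨hf1, hf2⟩ := hf
  obtain ⟨hg1, hg2⟩ := hg
  simp only at hf1 hf2 hg1 hg2
  simp only [eventVector, joinEvent]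
  rcases e1 with _ | p <;> rcases e2 with _ | q
  · simp
  · obtain rfl : f2 = none := by simpa using hf2
    obtain rfl : g2 = none := by simpa using hg2
    simp only [Option.none_or, Option.or_none, h2]
    simp only [hc', hFS, hFF, and_self]
  · obtain rfl : f1 = none := by simpa using hf1
    obtain rfl : g1 = none := by simpa using hg1
    simp only [Option.none_or, Option.or_none, h1, hES, hEE, and_self]
  · obtain rfl : f2 = none := by simpa using hf2
    obtain rfl : g2 = none := by simpa using hg2
    obtain rfl : f1 = none := by simpa using hf1
    obtain rfl : g1 = none := by simpa using hg1
    simp only [Option.or_none, h1, h2]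
    constructor
    · rw [hES, hEE, hc', hFS, hFF]
    · rw [hES, hEE, hES, hc', hFS, hFF, hFS]

end Operators

/-! ### Certificates of binary almost quantum distributions -/

/-- There is only one nonzero outcome, so the orthogonality condition is void. -/
theorem not_locallyOrthogonal {m : ℕ} (e f : Event m 2) : ¬ LocallyOrthogonal e f := by
  have h : ∀ a a' : {a : Fin 2 // a.val ≠ 0}, a = a' := by decide
  rintro (⟨_, a, a', _, _, hne⟩ | ⟨_, a, a', _, _, hne⟩) <;> exact hne (h a a')

/-- The real part of the Gram matrix of the vectors of events is a certificate. -/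
theorem exists_isCertificate {m : ℕ} {P : Box m 2} (hP : P ∈ almostQuantumSet.{u} m 2) :
    ∃ Γ, IsCertificate P Γ := by
  obtain ⟨-, H, _, _, _, φ, E, F, hφ, hE, hF, hc, hPE⟩ := hP
  have hre : ∀ a b x y, P a b x y = (inner ℂ φ (E a x (F b y φ))).re := fun a b x y => by
    rw [← hPE, Complex.ofReal_re]
  refine ⟨Matrix.of fun e f => (inner ℂ (eventVector φ E F e) (eventVector φ E F f)).re, ?_⟩
  constructor
  case posSemidef => exact posSemidef_re_inner _
  case orthogonal => exact fun e f h => (not_locallyOrthogonal e f h).elim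
  case null_null => simp [eventVector, localOp, hφ]
  case prob_fst =>
    intro x a y
    simp only [hre, ← Complex.re_sum, ← inner_sum, ← map_sum, hF.sum_apply]
    rfl
  case prob_snd =>
    intro y b x
    simp only [hre, ← Complex.re_sum, ← inner_sum, hE.sum_apply]
    rfl
  case prob_both => exact fun x a y b => (hre _ _ _ _).symm
  case consistent =>
    intro e f g hf hg
    obtain ⟨h1, h2⟩ := inner_eventVector_joinEvent hE hF hc hf hg
    exact ⟨congr_arg Complex.re h1, congr_arg Complex.re h2⟩

/-- For binary outcomes the probabilities are determined by normalization, the marginals of the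
outcome `1` and the probability that both outcomes are `1`. -/
theorem IsNonSignalling.ext_fin_two {m : ℕ} {P : Box m 2} (hP : IsNonSignalling P)
    {f : Fin 2 → Fin 2 → Fin m → Fin m → ℂ}
    (hsum : ∀ x y, ∑ a, ∑ b, f a b x y = 1)
    (h1 : ∀ x y, ∑ b, f 1 b x y = ∑ b, (P 1 b x y : ℂ))
    (h2 : ∀ x y, ∑ a, f a 1 x y = ∑ a, (P a 1 x y : ℂ))
    (h3 : ∀ x y, f 1 1 x y = P 1 1 x y) (a b x y) : (P a b x y : ℂ) = f a b x y := by
  have h0 : ∑ a, ∑ b, (P a b x y : ℂ) = 1 := mod_cast hP.sum_eq_one x y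
  have hs := hsum x y
  have h1 := h1 x y
  have h2 := h2 x y
  have h3 := h3 x y
  simp only [Fin.sum_univ_two] at h0 hs h1 h2
  fin_cases a <;> fin_cases b <;> simp only [Fin.zero_eta, Fin.mk_one]
  · linear_combination h0 - hs + h1 + h2 - h3
  · linear_combination h3 - h2
  · linear_combination h3 - h1
  · exact h3.symm

/-- The projection measurement with two outcomes whose outcome `1` is the projection onto `U x`. -/
noncomputable def binaryMeasurement {H : Type*} [NormedAddCommGroup H] [InnerProductSpace ℂ H]
    {m : ℕ} (U : Fin m → Submodule ℂ H) [∀ x, (U x).HasOrthogonalProjection] :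
    Fin 2 → Fin m → H →L[ℂ] H :=
  fun a x => ![1 - (U x).starProjection, (U x).starProjection] a

theorem isMeasurement_binaryMeasurement {H : Type*} [NormedAddCommGroup H] [InnerProductSpace ℂ H]
    [CompleteSpace H] {m : ℕ} (U : Fin m → Submodule ℂ H) [∀ x, (U x).HasOrthogonalProjection] :
    IsMeasurement (binaryMeasurement U) where
  projection a x := by
    fin_cases a
    · exact isStarProjection_starProjection.one_sub
    · exact isStarProjection_starProjection
  complete x := by simp [binaryMeasurement]

/-- A real positive semidefinite matrix is the Gram matrix of vectors in a finite-dimensional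
complex Hilbert space, which can be chosen in any universe. -/
theorem exists_inner_eq_of_posSemidef {ι : Type*} [Finite ι] {Γ : Matrix ι ι ℝ}
    (hΓ : Γ.PosSemidef) :
    ∃ (n : ℕ) (v : ι → EuclideanSpace ℂ (ULift.{u} (Fin n))),
      ∀ i j, inner ℂ (v i) (v j) = (Γ i j : ℂ) := by
  obtain ⟨n, w, hw⟩ := Matrix.posSemidef_iff_eq_sum_vecMulVec.1 hΓ
  refine ⟨n, fun i => WithLp.toLp 2 fun k => (w k.down i : ℂ), fun i j => ?_⟩
  rw [hw, PiLp.inner_apply, Matrix.sum_apply, Complex.ofReal_sum,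
    ← Equiv.sum_comp Equiv.ulift.{u}.symm]
  refine Finset.sum_congr rfl fun k _ => ?_
  simp [Matrix.vecMulVec_apply, mul_comm]

/-- The GNS-type construction: the outcome `1` of input `x` is the projection onto the span of all
vectors of events in which the party obtains it. -/
theorem IsCertificate.mem_almostQuantumSet {m : ℕ} {P : Box m 2} (hP : IsNonSignalling P)
    {Γ : Matrix (Event m 2) (Event m 2) ℝ} (hΓ : IsCertificate P Γ) :
    P ∈ almostQuantumSet.{u} m 2 := by
  obtain ⟨n, v, hv⟩ := exists_inner_eq_of_posSemidef.{u} hΓ.posSemidef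
  -- the only nonzero outcome
  let one : {a : Fin 2 // a.val ≠ 0} := ⟨1, by decide⟩
  let U (x : Fin m) := Submodule.span ℂ (Set.range fun g => v (some (x, one), g))
  let V (y : Fin m) := Submodule.span ℂ (Set.range fun f => v (f, some (y, one)))
  have hU (x g) : (U x).starProjection (v (none, g)) = v (some (x, one), g) := by
    refine (Submodule.eq_starProjection_of_mem_of_inner_eq_zero
      (Submodule.subset_span ⟨g, rfl⟩) fun w hw => ?_)
    induction hw using Submodule.span_induction with
    | mem w hw =>
      obtain ⟨g', rfl⟩ := hw
      have h := (hΓ.consistent (some (x, one), none) (none, g) (none, g')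
        ⟨.inr rfl, .inl rfl⟩ ⟨.inr rfl, .inl rfl⟩).1
      simp only [joinEvent, Option.or_none, Option.none_or] at h
      rw [inner_sub_left, hv, hv, h, sub_self]
    | zero => simp
    | add _ _ _ _ h h' => rw [inner_add_right, h, h', add_zero]
    | smul c _ _ h => rw [inner_smul_right, h, mul_zero]
  have hV (y f) : (V y).starProjection (v (f, none)) = v (f, some (y, one)) := by
    refine (Submodule.eq_starProjection_of_mem_of_inner_eq_zero
      (Submodule.subset_span ⟨f, rfl⟩) fun w hw => ?_)
    induction hw using Submodule.span_induction with
    | mem w hw =>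
      obtain ⟨f', rfl⟩ := hw
      have h := (hΓ.consistent (none, some (y, one)) (f, none) (f', none)
        ⟨.inl rfl, .inr rfl⟩ ⟨.inl rfl, .inr rfl⟩).1
      simp only [joinEvent, Option.or_none, Option.none_or] at h
      rw [inner_sub_left, hv, hv, h, sub_self]
    | zero => simp
    | add _ _ _ _ h h' => rw [inner_add_right, h, h', add_zero]
    | smul c _ _ h => rw [inner_smul_right, h, mul_zero]
  set φ := v (none, none)
  have hE := isMeasurement_binaryMeasurement U
  have hF := isMeasurement_binaryMeasurement V
  have hφ : inner ℂ φ φ = (1 : ℂ) := by rw [hv, hΓ.null_null, Complex.ofReal_one]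
  refine ⟨hP, _, inferInstance, inferInstance, inferInstance, φ, binaryMeasurement U,
    binaryMeasurement V, ?_, hE, hF, ?_, ?_⟩
  · rw [← pow_eq_one_iff_of_nonneg (norm_nonneg φ) two_ne_zero,
      norm_sq_eq_re_inner (𝕜 := ℂ), hφ, RCLike.one_re]
  · intro a b x y
    have h : (U x).starProjection ((V y).starProjection φ) =
        (V y).starProjection ((U x).starProjection φ) := by rw [hV, hU, hU, hV]
    fin_cases a <;> fin_cases b <;> simp [binaryMeasurement, h]
    abel
  · refine hP.ext_fin_two (f := fun a b x y => inner ℂ φ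
      (binaryMeasurement U a x (binaryMeasurement V b y φ))) ?_ ?_ ?_ ?_
    · intro x y
      rw [Finset.sum_comm]
      simp only [← inner_sum, hE.sum_apply, hF.sum_apply, hφ]
    · intro x y
      simp only [← inner_sum, ← map_sum, hF.sum_apply]
      rw [← Complex.ofReal_sum, ← hΓ.prob_fst x one y, ← hv, ← hU]
      rfl
    · intro x y
      simp only [← inner_sum, hE.sum_apply]
      rw [← Complex.ofReal_sum, ← hΓ.prob_snd y one x, ← hv, ← hV]
      rfl
    · intro x y
      rw [← hΓ.prob_both x one y one, ← hv, ← hU, ← hV]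
      rfl

/-! ### The almost quantum set is closed -/

section Closed

variable {m d : ℕ}

theorem IsNonSignalling.le_one {P : Box m d} (hP : IsNonSignalling P) (a b x y) :
    P a b x y ≤ 1 := by
  rw [← hP.sum_eq_one x y]
  calc P a b x y ≤ ∑ b', P a b' x y :=
        Finset.single_le_sum (f := fun b' => P a b' x y) (fun b' _ => hP.nonneg a b' x y)
          (Finset.mem_univ b)
    _ ≤ ∑ a', ∑ b', P a' b' x y :=
        Finset.single_le_sum (f := fun a' => ∑ b', P a' b' x y)
          (fun a' _ => Finset.sum_nonneg fun b' _ => hP.nonneg a' b' x y) (Finset.mem_univ a)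

theorem isClosed_setOf_isNonSignalling : IsClosed {P : Box m d | IsNonSignalling P} := by
  have h : {P : Box m d | IsNonSignalling P} =
      {P | (∀ a b x y, 0 ≤ P a b x y) ∧ (∀ x y, ∑ a, ∑ b, P a b x y = 1) ∧
        (∀ a x y y', ∑ b, P a b x y = ∑ b, P a b x y') ∧
        ∀ b y x x', ∑ a, P a b x y = ∑ a, P a b x' y} :=
    Set.ext fun P => ⟨fun h => ⟨h.1, h.2, h.3, h.4⟩, fun h => ⟨h.1, h.2.1, h.2.2.1, h.2.2.2⟩⟩
  rw [h]
  simp only [Set.ofPred_and, Set.ofPred_forall]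
  refine (isClosed_iInter fun a => isClosed_iInter fun b => isClosed_iInter fun x =>
      isClosed_iInter fun y => isClosed_le (by fun_prop) (by fun_prop)).inter
    ((isClosed_iInter fun x => isClosed_iInter fun y =>
      isClosed_eq (by fun_prop) (by fun_prop)).inter
    ((isClosed_iInter fun a => isClosed_iInter fun x => isClosed_iInter fun y =>
      isClosed_iInter fun y' => isClosed_eq (by fun_prop) (by fun_prop)).inter
    (isClosed_iInter fun b => isClosed_iInter fun y => isClosed_iInter fun x =>
      isClosed_iInter fun x' => isClosed_eq (by fun_prop) (by fun_prop))))

theorem _root_.Matrix.isClosed_setOf_posSemidef {ι : Type*} [Fintype ι] :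
    IsClosed {M : Matrix ι ι ℝ | M.PosSemidef} := by
  simp only [Matrix.posSemidef_iff_dotProduct_mulVec, Matrix.IsHermitian, Set.ofPred_and,
    Set.ofPred_forall]
  refine (isClosed_eq (by fun_prop) (by fun_prop)).inter (isClosed_iInter fun x => ?_)
  exact isClosed_le (by fun_prop) (by fun_prop)

theorem isClosed_setOf_isCertificate :
    IsClosed {q : Box m d × Matrix (Event m d) (Event m d) ℝ | IsCertificate q.1 q.2} := by
  have h : {q : Box m d × Matrix (Event m d) (Event m d) ℝ | IsCertificate q.1 q.2} =
      {q | q.2 ∈ {M : Matrix (Event m d) (Event m d) ℝ | M.PosSemidef} ∧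
        (∀ e f, LocallyOrthogonal e f → q.2 e f = 0) ∧
        q.2 (none, none) (none, none) = 1 ∧
        (∀ x a y, q.2 (none, none) (some (x, a), none) = ∑ b, q.1 a.1 b x y) ∧
        (∀ y b x, q.2 (none, none) (none, some (y, b)) = ∑ a, q.1 a b.1 x y) ∧
        (∀ x a y b, q.2 (none, none) (some (x, a), some (y, b)) = q.1 a.1 b.1 x y) ∧
        ∀ e f g, DisjointParties e f → DisjointParties e g →
          q.2 (joinEvent e f) (joinEvent e g) = q.2 f (joinEvent e g) ∧
          q.2 (joinEvent e f) (joinEvent e g) = q.2 (joinEvent e f) g} :=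
    Set.ext fun q => ⟨fun h => ⟨h.1, h.2, h.3, h.4, h.5, h.6, h.7⟩,
      fun ⟨h1, h2, h3, h4, h5, h6, h7⟩ => ⟨h1, h2, h3, h4, h5, h6, h7⟩⟩
  rw [h]
  simp only [Set.ofPred_and, Set.ofPred_forall]
  refine (Matrix.isClosed_setOf_posSemidef.preimage continuous_snd).inter ?_
  refine (isClosed_iInter fun e => isClosed_iInter fun f => isClosed_iInter fun _ =>
    isClosed_eq (by fun_prop) (by fun_prop)).inter ?_
  refine (isClosed_eq (by fun_prop) (by fun_prop)).inter ?_
  refine (isClosed_iInter fun x => isClosed_iInter fun a => isClosed_iInter fun y =>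
    isClosed_eq (by fun_prop) (by fun_prop)).inter ?_
  refine (isClosed_iInter fun y => isClosed_iInter fun b => isClosed_iInter fun x =>
    isClosed_eq (by fun_prop) (by fun_prop)).inter ?_
  refine (isClosed_iInter fun x => isClosed_iInter fun a => isClosed_iInter fun y =>
    isClosed_iInter fun b => isClosed_eq (by fun_prop) (by fun_prop)).inter ?_
  exact isClosed_iInter fun e => isClosed_iInter fun f => isClosed_iInter fun g =>
    isClosed_iInter fun _ => isClosed_iInter fun _ =>
    (isClosed_eq (by fun_prop) (by fun_prop)).inter (isClosed_eq (by fun_prop) (by fun_prop))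

/-- A diagonal entry of a certificate is a probability. -/
theorem IsCertificate.apply_self_le_one {P : Box m d} (hP : IsNonSignalling P)
    {Γ : Matrix (Event m d) (Event m d) ℝ} (hΓ : IsCertificate P Γ) (e : Event m d) :
    Γ e e ≤ 1 := by
  have h := (hΓ.consistent e (none, none) (none, none) ⟨.inr rfl, .inr rfl⟩
    ⟨.inr rfl, .inr rfl⟩).1
  simp only [joinEvent, Option.or_none] at h
  rw [h]
  rcases e with ⟨_ | ⟨x, a⟩, _ | ⟨y, b⟩⟩
  · exact hΓ.null_null.le
  · rw [hΓ.prob_snd y b y, ← hP.sum_eq_one y y]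
    exact Finset.sum_le_sum fun a' _ => Finset.single_le_sum (f := fun b' => P a' b' y y)
      (fun b' _ => hP.nonneg a' b' y y) (Finset.mem_univ b.1)
  · rw [hΓ.prob_fst x a x, ← hP.sum_eq_one x x]
    exact Finset.single_le_sum (f := fun a' => ∑ b', P a' b' x x)
      (fun a' _ => Finset.sum_nonneg fun b' _ => hP.nonneg a' b' x x) (Finset.mem_univ a.1)
  · rw [hΓ.prob_both]
    exact hP.le_one _ _ _ _

theorem IsCertificate.abs_apply_le_one {P : Box m d} (hP : IsNonSignalling P)
    {Γ : Matrix (Event m d) (Event m d) ℝ} (hΓ : IsCertificate P Γ) (e f : Event m d) :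
    |Γ e f| ≤ 1 := by
  obtain ⟨n, v, hv⟩ := exists_inner_eq_of_posSemidef.{0} hΓ.posSemidef
  have hn (e) : ‖v e‖ ≤ 1 := by
    rw [← sq_le_one_iff₀ (norm_nonneg _), norm_sq_eq_re_inner (𝕜 := ℂ), hv]
    exact hΓ.apply_self_le_one hP e
  calc |Γ e f| = ‖inner ℂ (v e) (v f)‖ := by rw [hv, Complex.norm_real, Real.norm_eq_abs]
    _ ≤ ‖v e‖ * ‖v f‖ := norm_inner_le_norm _ _
    _ ≤ 1 := mul_le_one₀ (hn e) (norm_nonneg _) (hn f)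

theorem mem_almostQuantumSet_iff {P : Box m 2} :
    P ∈ almostQuantumSet.{u} m 2 ↔ IsNonSignalling P ∧ ∃ Γ, IsCertificate P Γ :=
  ⟨fun h => ⟨h.1, exists_isCertificate h⟩, fun ⟨h, _, hΓ⟩ => hΓ.mem_almostQuantumSet h⟩

/-- The almost quantum set is the projection of the compact set of pairs of a distribution and a
certificate. -/
theorem isClosed_almostQuantumSet : IsClosed (almostQuantumSet.{u} m 2) := by
  let C : Set (Matrix (Event m 2) (Event m 2) ℝ) :=
    Set.univ.pi fun _ => Set.univ.pi fun _ => Set.Icc (-1) 1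
  have hC : IsCompact C := isCompact_univ_pi fun _ => isCompact_univ_pi fun _ => isCompact_Icc
  let D : Set (Box m 2) := Set.univ.pi fun _ => Set.univ.pi fun _ => Set.univ.pi fun _ =>
    Set.univ.pi fun _ => Set.Icc 0 1
  have hD : IsCompact D := isCompact_univ_pi fun _ => isCompact_univ_pi fun _ =>
    isCompact_univ_pi fun _ => isCompact_univ_pi fun _ => isCompact_Icc
  have hK : IsCompact ({q : Box m 2 × Matrix (Event m 2) (Event m 2) ℝ |
      IsNonSignalling q.1} ∩ {q | IsCertificate q.1 q.2}) := by
    refine (hD.prod hC).of_isClosed_subset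
      ((isClosed_setOf_isNonSignalling.preimage continuous_fst).inter
        isClosed_setOf_isCertificate) ?_
    rintro ⟨P, Γ⟩ ⟨hP, hΓ⟩
    exact ⟨fun a _ b _ x _ y _ => ⟨hP.nonneg a b x y, hP.le_one a b x y⟩,
      fun e _ f _ => abs_le.1 (hΓ.abs_apply_le_one hP e f)⟩
  have h : almostQuantumSet.{u} m 2 = Prod.fst '' ({q : Box m 2 × Matrix (Event m 2) (Event m 2) ℝ |
      IsNonSignalling q.1} ∩ {q | IsCertificate q.1 q.2}) := by
    ext P
    rw [mem_almostQuantumSet_iff]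
    exact ⟨fun ⟨hP, Γ, hΓ⟩ => ⟨(P, Γ), ⟨hP, hΓ⟩, rfl⟩,
      fun ⟨⟨_, Γ⟩, ⟨hP, hΓ⟩, h⟩ => h ▸ ⟨hP, Γ, hΓ⟩⟩
  rw [h]
  exact (hK.image continuous_fst).isClosed

end Closed

/-! ### Operators on the tensor product -/

section Tensor

variable {H K : Type u} [NormedAddCommGroup H] [InnerProductSpace ℂ H]
    [NormedAddCommGroup K] [InnerProductSpace ℂ K]

theorem tensorOp_coe (S : H →L[ℂ] H) (T : K →L[ℂ] K) (v : H ⊗[ℂ] K) :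
    tensorOp S T (v : HilbertTensor H K) = (TensorProduct.mapL S T v : H ⊗[ℂ] K) :=
  ContinuousLinearMap.completion_apply_coe _ _

theorem tensorOp_comp (S S' : H →L[ℂ] H) (T T' : K →L[ℂ] K) :
    tensorOp S T * tensorOp S' T' = tensorOp (S * S') (T * T') := by
  ext v
  induction v using UniformSpace.Completion.induction_on with
  | hp => exact isClosed_eq (by fun_prop) (by fun_prop)
  | ih v =>
    rw [mul_apply_eq_comp, tensorOp_coe, tensorOp_coe, tensorOp_coe]
    congr 1
    induction v with
    | zero => simp
    | tmul => simp
    | add v w hv hw => simp only [map_add, hv, hw]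

theorem tensorOp_one : tensorOp (1 : H →L[ℂ] H) (1 : K →L[ℂ] K) = 1 := by
  ext v
  induction v using UniformSpace.Completion.induction_on with
  | hp => exact isClosed_eq (by fun_prop) (by fun_prop)
  | ih v =>
    rw [tensorOp_coe, one_apply_eq_self]
    congr 1
    induction v with
    | zero => simp
    | tmul => simp
    | add v w hv hw => rw [map_add, hv, hw]

theorem tensorOp_add_left (S S' : H →L[ℂ] H) (T : K →L[ℂ] K) :
    tensorOp (S + S') T = tensorOp S T + tensorOp S' T := by
  ext v
  induction v using UniformSpace.Completion.induction_on with
  | hp => exact isClosed_eq (by fun_prop) (by fun_prop)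
  | ih v =>
    rw [add_apply, tensorOp_coe, tensorOp_coe, tensorOp_coe, TensorProduct.mapL_add_left,
      add_apply, UniformSpace.Completion.coe_add]

theorem tensorOp_add_right (S : H →L[ℂ] H) (T T' : K →L[ℂ] K) :
    tensorOp S (T + T') = tensorOp S T + tensorOp S T' := by
  ext v
  induction v using UniformSpace.Completion.induction_on with
  | hp => exact isClosed_eq (by fun_prop) (by fun_prop)
  | ih v =>
    rw [add_apply, tensorOp_coe, tensorOp_coe, tensorOp_coe, TensorProduct.mapL_add_right,
      add_apply, UniformSpace.Completion.coe_add]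

theorem isStarProjection_tensorOp [CompleteSpace H] [CompleteSpace K] {S : H →L[ℂ] H}
    {T : K →L[ℂ] K} (hS : IsStarProjection S) (hT : IsStarProjection T) :
    IsStarProjection (tensorOp S T) := by
  refine ⟨by rw [IsIdempotentElem, tensorOp_comp, hS.isIdempotentElem.eq, hT.isIdempotentElem.eq],
    ?_⟩
  rw [IsSelfAdjoint, ContinuousLinearMap.star_eq_adjoint, eq_comm,
    ContinuousLinearMap.eq_adjoint_iff]
  intro v w
  induction v, w using UniformSpace.Completion.induction_on₂ with
  | hp => exact isClosed_eq (by fun_prop) (by fun_prop)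
  | ih v w =>
    rw [tensorOp_coe, tensorOp_coe, UniformSpace.Completion.inner_coe,
      UniformSpace.Completion.inner_coe]
    induction v with
    | zero => simp
    | add v v' hv hv' => rw [map_add, inner_add_left, inner_add_left, hv, hv']
    | tmul x y =>
      induction w with
      | zero => simp
      | add w w' hw hw' => rw [map_add, inner_add_right, inner_add_right, hw, hw']
      | tmul x' y' =>
        simp [inner_apply_left_of_isStarProjection hS, inner_apply_left_of_isStarProjection hT]

variable [CompleteSpace H] [CompleteSpace K] {m d : ℕ}

theorem IsMeasurement.tensorOp_one {E : Fin d → Fin m → H →L[ℂ] H} (hE : IsMeasurement E) :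
    IsMeasurement fun a x => tensorOp (E a x) (1 : K →L[ℂ] K) where
  projection a x := isStarProjection_tensorOp (hE.projection a x) (.one _)
  complete x := by
    rw [← AlmostQuantum.tensorOp_one, ← hE.complete x]
    exact (map_sum (AddMonoidHom.mk' (fun S : H →L[ℂ] H => tensorOp S (1 : K →L[ℂ] K))
      fun S S' => tensorOp_add_left S S' 1) (fun a => E a x) Finset.univ).symm

theorem IsMeasurement.one_tensorOp {F : Fin d → Fin m → K →L[ℂ] K} (hF : IsMeasurement F) :
    IsMeasurement fun b y => tensorOp (1 : H →L[ℂ] H) (F b y) where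
  projection b y := isStarProjection_tensorOp (.one _) (hF.projection b y)
  complete y := by
    rw [← AlmostQuantum.tensorOp_one, ← hF.complete y]
    exact (map_sum (AddMonoidHom.mk' (fun T : K →L[ℂ] K => tensorOp (1 : H →L[ℂ] H) T)
      fun T T' => tensorOp_add_right 1 T T') (fun b => F b y) Finset.univ).symm

end Tensor

/-- On the tensor product, the operators `E ⊗ 1` and `1 ⊗ F` of the two parties commute. -/
theorem exists_commuting_of_mem_quantumSet {m d : ℕ} {P : Box m d}
    (hP : P ∈ quantumSet.{u} m d) :
    ∃ (H : Type u) (_ : NormedAddCommGroup H) (_ : InnerProductSpace ℂ H) (_ : CompleteSpace H)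
      (φ : H) (E F : Fin d → Fin m → H →L[ℂ] H),
      ‖φ‖ = 1 ∧ IsMeasurement E ∧ IsMeasurement F ∧
      (∀ a b x y, Commute (E a x) (F b y)) ∧
      ∀ a b x y, (P a b x y : ℂ) = inner ℂ φ (E a x (F b y φ)) := by
  obtain ⟨-, H, _, _, _, K, _, _, _, φ, E, F, hφ, hE, hF, hPE⟩ := hP
  refine ⟨HilbertTensor H K, inferInstance, inferInstance, inferInstance, φ, _, _, hφ,
    hE.tensorOp_one, hF.one_tensorOp, fun a b x y => ?_, fun a b x y => ?_⟩
  · rw [Commute, SemiconjBy, tensorOp_comp, tensorOp_comp, one_mul, one_mul, mul_one, mul_one]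
  · rw [hPE, ← mul_apply_eq_comp, tensorOp_comp, one_mul, mul_one]

theorem quantumSet_subset_almostQuantumSet {m d : ℕ} :
    quantumSet.{u} m d ⊆ almostQuantumSet.{u} m d := by
  intro P hP
  obtain ⟨H, i1, i2, i3, φ, E, F, hφ, hE, hF, hc, hPE⟩ := exists_commuting_of_mem_quantumSet hP
  exact ⟨hP.1, H, i1, i2, i3, φ, E, F, hφ, hE, hF,
    fun a b x y => congr($((hc a b x y).eq) φ), hPE⟩

/-! ### The Bell functional on commuting projections -/

theorem sum_mul_re_inner_nonneg {ι H : Type*} [Fintype ι] [NormedAddCommGroup H]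
    [InnerProductSpace ℂ H] (v : ι → H) (c : ι → ℝ) :
    0 ≤ ∑ i, ∑ j, c i * (c j * (inner ℂ (v i) (v j)).re) := by
  have h := (posSemidef_re_inner v).dotProduct_mulVec_nonneg c
  simpa [dotProduct, Matrix.mulVec, Finset.mul_sum, mul_comm, mul_left_comm] using h

/-- The coefficients, times `10 ^ 4`, of the operators whose squares are summed in
`neg_one_lt_of_commute`, one operator in each row. The columns correspond to the products
`1, B₀, B₁, A₀, A₀B₀, A₀B₁, A₁, A₁B₁, A₀B₁B₀, A₁A₀B₀, A₁A₀`. The rows form the rounded transposed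
Cholesky factor of an interior point of the dual semidefinite program for the minimum of the Bell
functional. -/
def bellFactor : Matrix (Fin 11) (Fin 11) ℝ :=
  !![9927, 4962, -10239, -11180, -19980, -5409, 9662, -15009, 20976, 3463, 12884;
    0, 41622, 1220, 223, -38806, 10438, -13896, 1789, 10690, -11133, 5149;
    0, 0, 420, 1, 49, 7899, 23672, -18717, -1140, -11400, 977;
    0, 0, 0, 379, -468, -346, -142, -90, 457, 528, -381;
    0, 0, 0, 0, 1228, 349, -1805, 2031, -1347, -337, -88;
    0, 0, 0, 0, 0, 9031, 22289, -16164, -3475, -10645, 900;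
    0, 0, 0, 0, 0, 0, 17801, -19772, 495, 5999, -6354;
    0, 0, 0, 0, 0, 0, 0, 7388, 137, -14017, 6963;
    0, 0, 0, 0, 0, 0, 0, 0, 1936, -2768, 1342;
    0, 0, 0, 0, 0, 0, 0, 0, 0, 1165, -839;
    0, 0, 0, 0, 0, 0, 0, 0, 0, 0, 522]

set_option maxHeartbeats 4000000 in
/-- The Bell functional exceeds `-1` if the projections of the two parties commute. -/
theorem neg_one_lt_of_commute {H : Type*} [NormedAddCommGroup H] [InnerProductSpace ℂ H]
    [CompleteSpace H] {φ : H} (hφ : ‖φ‖ = 1) {A₀ A₁ B₀ B₁ : H →L[ℂ] H}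
    (hA₀ : IsStarProjection A₀) (hA₁ : IsStarProjection A₁) (hB₀ : IsStarProjection B₀)
    (hB₁ : IsStarProjection B₁) (h₀₀ : Commute A₀ B₀) (h₀₁ : Commute A₀ B₁)
    (h₁₀ : Commute A₁ B₀) (h₁₁ : Commute A₁ B₁) :
    -1 < (-(30 / 31)) * (inner ℂ φ (A₀ φ)).re + 167 / 9 * (inner ℂ φ (A₁ φ)).re +
      167 / 9 * (inner ℂ φ (B₀ φ)).re + (-(30 / 31)) * (inner ℂ φ (B₁ φ)).re +
      (-(174 / 11)) * (inner ℂ φ (A₀ (B₀ φ))).re + (-(244 / 23)) * (inner ℂ φ (A₁ (B₀ φ))).re +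
      74 / 11 * (inner ℂ φ (A₀ (B₁ φ))).re + (-(174 / 11)) * (inner ℂ φ (A₁ (B₁ φ))).re := by
  let v : Fin 11 → H := ![φ, B₀ φ, B₁ φ, A₀ φ, A₀ (B₀ φ), A₀ (B₁ φ), A₁ φ, A₁ (B₁ φ),
    A₀ (B₁ (B₀ φ)), A₁ (A₀ (B₀ φ)), A₁ (A₀ φ)]
  have sA₀ := inner_apply_left_of_isStarProjection hA₀
  have sA₁ := inner_apply_left_of_isStarProjection hA₁
  have sB₀ := inner_apply_left_of_isStarProjection hB₀
  have sB₁ := inner_apply_left_of_isStarProjection hB₁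
  have iA₀ := apply_apply_of_isStarProjection hA₀
  have iA₁ := apply_apply_of_isStarProjection hA₁
  have iB₀ := apply_apply_of_isStarProjection hB₀
  have iB₁ := apply_apply_of_isStarProjection hB₁
  have c₀₀ (w : H) : B₀ (A₀ w) = A₀ (B₀ w) := congr($(h₀₀.eq.symm) w)
  have c₀₁ (w : H) : B₁ (A₀ w) = A₀ (B₁ w) := congr($(h₀₁.eq.symm) w)
  have c₁₀ (w : H) : B₀ (A₁ w) = A₁ (B₀ w) := congr($(h₁₀.eq.symm) w)
  have c₁₁ (w : H) : B₁ (A₁ w) = A₁ (B₁ w) := congr($(h₁₁.eq.symm) w)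
  have hre (x y : H) : (inner ℂ x y).re = (inner ℂ y x).re := inner_re_symm (𝕜 := ℂ) x y
  -- A product and its adjoint have the same moment; the right-hand sides are the normal forms.
  have r₁ : (inner ℂ φ (B₁ (B₀ φ))).re = (inner ℂ φ (B₀ (B₁ φ))).re := by
    rw [hre, sB₁, sB₀]
  have r₂ : (inner ℂ φ (A₀ (B₁ (B₀ φ)))).re = (inner ℂ φ (A₀ (B₀ (B₁ φ)))).re := by
    rw [hre]; simp only [sA₀, sB₁, sB₀, c₀₀, c₀₁]
  have r₃ : (inner ℂ φ (A₁ (B₁ (B₀ φ)))).re = (inner ℂ φ (A₁ (B₀ (B₁ φ)))).re := by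
    rw [hre]; simp only [sA₁, sB₁, sB₀, c₁₀, c₁₁]
  have r₄ : (inner ℂ φ (A₁ (A₀ φ))).re = (inner ℂ φ (A₀ (A₁ φ))).re := by
    rw [hre]; simp only [sA₁, sA₀]
  have r₅ : (inner ℂ φ (A₁ (A₀ (B₀ φ)))).re = (inner ℂ φ (A₀ (A₁ (B₀ φ)))).re := by
    rw [hre]; simp only [sA₁, sA₀, sB₀, c₀₀, c₁₀]
  have r₆ : (inner ℂ φ (A₁ (A₀ (B₁ φ)))).re = (inner ℂ φ (A₀ (A₁ (B₁ φ)))).re := by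
    rw [hre]; simp only [sA₁, sA₀, sB₁, c₀₁, c₁₁]
  have r₇ : (inner ℂ φ (A₁ (A₀ (B₁ (B₀ φ))))).re = (inner ℂ φ (A₀ (A₁ (B₀ (B₁ φ))))).re := by
    rw [hre]; simp only [sA₁, sA₀, sB₁, sB₀, c₀₁, c₁₁, c₀₀, c₁₀]
  have r₈ : (inner ℂ φ (A₀ (A₁ (A₀ (B₁ (B₀ φ)))))).re =
      (inner ℂ φ (A₀ (A₁ (A₀ (B₀ (B₁ φ)))))).re := by
    rw [hre]; simp only [sA₁, sA₀, sB₁, sB₀, c₀₁, c₁₁, c₀₀, c₁₀]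
  have h1 : (inner ℂ φ φ).re = 1 := by
    rw [inner_self_eq_norm_sq_to_K, hφ]; norm_num
  have nA₀ {w : H} (hw : ‖w‖ ≤ 1) : ‖A₀ w‖ ≤ 1 :=
    (norm_apply_le_of_isStarProjection hA₀ w).trans hw
  have nA₁ {w : H} (hw : ‖w‖ ≤ 1) : ‖A₁ w‖ ≤ 1 :=
    (norm_apply_le_of_isStarProjection hA₁ w).trans hw
  have nB₀ {w : H} (hw : ‖w‖ ≤ 1) : ‖B₀ w‖ ≤ 1 :=
    (norm_apply_le_of_isStarProjection hB₀ w).trans hw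
  have nB₁ {w : H} (hw : ‖w‖ ≤ 1) : ‖B₁ w‖ ≤ 1 :=
    (norm_apply_le_of_isStarProjection hB₁ w).trans hw
  have nφ : ‖φ‖ ≤ 1 := hφ.le
  have hb {w : H} (hw : ‖w‖ ≤ 1) : |(inner ℂ φ w).re| ≤ 1 :=
    (Complex.abs_re_le_norm _).trans ((norm_inner_le_norm _ _).trans (by rwa [hφ, one_mul]))
  have lower {w : H} (hw : ‖w‖ ≤ 1) : -1 ≤ (inner ℂ φ w).re := (abs_le.1 (hb hw)).1
  have upper {w : H} (hw : ‖w‖ ≤ 1) : (inner ℂ φ w).re ≤ 1 := (abs_le.1 (hb hw)).2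
  -- The squared norm of each combination is linear in the moments, which the rules above reduce
  -- to normal form.
  have b (k : Fin 11) := sum_mul_re_inner_nonneg v (bellFactor k)
  simp [Fin.forall_fin_succ, Fin.sum_univ_succ, v, bellFactor, sA₀, sA₁, sB₀, sB₁, iA₀, iA₁,
    iB₀, iB₁, c₀₀, c₀₁, c₁₀, c₁₁, r₁, r₂, r₃, r₄, r₅, r₆, r₇, r₈, h1,
    -inner_self_eq_norm_sq_to_K] at b
  obtain ⟨b₀, b₁, b₂, b₃, b₄, b₅, b₆, b₇, b₈, b₉, b₁₀⟩ := b
  -- The sum of these inequalities, times `10⁻⁸`, is the Bell functional plus a constant below `1`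
  -- up to small coefficients, which the bounds on the moments absorb.
  linarith [
    lower (nB₀ nφ), lower (nB₁ nφ), lower (nA₀ nφ), upper (nA₀ (nB₀ nφ)), lower (nA₀ (nB₁
    nφ)), upper (nA₁ nφ), lower (nA₁ (nB₁ nφ)), upper (nA₀ (nB₀ (nB₁ nφ))), lower (nA₀
    (nA₁ (nB₀ nφ))), lower (nA₀ (nA₁ nφ)), lower (nB₀ (nB₁ nφ)), lower (nA₁ (nB₀ nφ)),
    lower (nA₁ (nB₀ (nB₁ nφ))), upper (nA₀ (nB₀ (nB₁ (nB₀ nφ)))), upper (nA₀ (nA₁ (nB₀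
    (nB₁ nφ)))), upper (nA₀ (nA₁ (nB₁ nφ))), upper (nA₀ (nA₁ (nA₀ (nB₀ nφ)))), lower (nA₀
    (nA₁ (nA₀ nφ))), lower (nA₀ (nA₁ (nA₀ (nB₀ (nB₁ nφ))))), upper (nA₀ (nA₁ (nA₀ (nB₁
    nφ)))), upper (nA₀ (nA₁ (nA₀ (nB₀ (nB₁ (nB₀ nφ))))))]

/-! ### The explicit distribution -/

theorem ofVector_sum_snd (p : Fin 8 → ℝ) (a x y) :
    ∑ b, ofVector p a b x y = ![1 - ![p 0, p 1] x, ![p 0, p 1] x] a := by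
  fin_cases a <;> simp [ofVector]

theorem ofVector_sum_fst (p : Fin 8 → ℝ) (b x y) :
    ∑ a, ofVector p a b x y = ![1 - ![p 2, p 3] y, ![p 2, p 3] y] b := by
  fin_cases b <;> simp [ofVector]
  ring

theorem toVector_ofVector (p : Fin 8 → ℝ) : toVector (ofVector p) = p := by
  ext i
  simp only [toVector, ofVector_sum_fst, ofVector_sum_snd]
  fin_cases i <;> simp [ofVector]

theorem isNonSignalling_ofVector {p : Fin 8 → ℝ} (hp : ∀ a b x y, 0 ≤ ofVector p a b x y) :
    IsNonSignalling (ofVector p) where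
  nonneg := hp
  sum_eq_one x y := by simp only [ofVector_sum_snd]; simp [Fin.sum_univ_two]
  marginal_fst a x y y' := by simp only [ofVector_sum_snd]
  marginal_snd b y x x' := by simp only [ofVector_sum_fst]

theorem isNonSignalling_explicitBox : IsNonSignalling explicitBox := by
  obtain ⟨h, h'⟩ := sqrt_two_bounds
  refine isNonSignalling_ofVector fun a b x y => ?_
  fin_cases a <;> fin_cases b <;> fin_cases x <;> fin_cases y <;>
    simp [ofVector, explicitVector] <;> linarith

theorem isCertificate_explicitMatrix :
    IsCertificate explicitBox (explicitMatrix.submatrix eventIndex eventIndex) where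
  posSemidef := explicitMatrix_posSemidef.submatrix eventIndex
  orthogonal e f h := (not_locallyOrthogonal e f h).elim
  null_null := rfl
  prob_fst := by
    rintro x ⟨a, ha⟩ y
    obtain rfl : a = 1 := by fin_cases a <;> simp_all
    rw [explicitBox, ofVector_sum_snd]
    fin_cases x <;> simp [explicitVector, explicitMatrix, eventIndex]
  prob_snd := by
    rintro y ⟨b, hb⟩ x
    obtain rfl : b = 1 := by fin_cases b <;> simp_all
    rw [explicitBox, ofVector_sum_fst]
    fin_cases y <;> simp [explicitVector, explicitMatrix, eventIndex]
  prob_both := by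
    rintro x ⟨a, ha⟩ y ⟨b, hb⟩
    obtain rfl : a = 1 := by fin_cases a <;> simp_all
    obtain rfl : b = 1 := by fin_cases b <;> simp_all
    fin_cases x <;> fin_cases y <;>
      simp [explicitBox, ofVector, explicitVector, explicitMatrix, eventIndex]
  consistent := by
    rintro ⟨e₁, e₂⟩ ⟨f₁, f₂⟩ ⟨g₁, g₂⟩ ⟨hf₁, hf₂⟩ ⟨hg₁, hg₂⟩
    simp only at hf₁ hf₂ hg₁ hg₂
    rcases e₁ with _ | ⟨x, a⟩ <;> rcases e₂ with _ | ⟨y, b⟩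
    · exact ⟨rfl, rfl⟩
    · obtain rfl : f₂ = none := by simpa using hf₂
      obtain rfl : g₂ = none := by simpa using hg₂
      rcases f₁ with _ | ⟨x, a⟩ <;> rcases g₁ with _ | ⟨x', a'⟩ <;> fin_cases y <;>
        try fin_cases x
      all_goals try fin_cases x'
      all_goals simp [joinEvent, explicitMatrix, eventIndex]
    · obtain rfl : f₁ = none := by simpa using hf₁
      obtain rfl : g₁ = none := by simpa using hg₁
      rcases f₂ with _ | ⟨y, b⟩ <;> rcases g₂ with _ | ⟨y', b'⟩ <;> fin_cases x <;>
        try fin_cases y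
      all_goals try fin_cases y'
      all_goals simp [joinEvent, explicitMatrix, eventIndex]
    · obtain rfl : f₁ = none := by simpa using hf₁
      obtain rfl : g₁ = none := by simpa using hg₁
      obtain rfl : f₂ = none := by simpa using hf₂
      obtain rfl : g₂ = none := by simpa using hg₂
      fin_cases x <;> fin_cases y <;> simp [joinEvent, explicitMatrix, eventIndex]

theorem bell_eq (P : Box 2 2) : bell P =
    (-(30 / 31)) * (∑ b, P 1 b 0 0) + 167 / 9 * (∑ b, P 1 b 1 0) +
      167 / 9 * (∑ a, P a 1 0 0) + (-(30 / 31)) * (∑ a, P a 1 0 1) +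
      (-(174 / 11)) * P 1 1 0 0 + (-(244 / 23)) * P 1 1 1 0 + 74 / 11 * P 1 1 0 1 +
      (-(174 / 11)) * P 1 1 1 1 := by
  simp [bell, bellVector, toVector, dotProduct, Fin.sum_univ_succ]
  ring

theorem abs_bell_explicitBox_sub_lt : |bell explicitBox - (-1.0029)| < 0.00005 := by
  obtain ⟨h, h'⟩ := sqrt_two_bounds
  rw [bell, explicitBox, toVector_ofVector, abs_lt]
  simp [bellVector, explicitVector, dotProduct, Fin.sum_univ_succ]
  constructor <;> linarith

theorem neg_one_lt_bell {P : Box 2 2} (hP : P ∈ quantumSet.{u} 2 2) : -1 < bell P := by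
  obtain ⟨H, _, _, _, φ, E, F, hφ, hE, hF, hc, hPE⟩ := exists_commuting_of_mem_quantumSet hP
  have hre : ∀ a b x y, P a b x y = (inner ℂ φ (E a x (F b y φ))).re := fun a b x y => by
    rw [← hPE, Complex.ofReal_re]
  have h₁ (a x y) : ∑ b, P a b x y = (inner ℂ φ (E a x φ)).re := by
    simp only [hre, ← Complex.re_sum, ← inner_sum, ← map_sum, hF.sum_apply]
  have h₂ (b x y) : ∑ a, P a b x y = (inner ℂ φ (F b y φ)).re := by
    simp only [hre, ← Complex.re_sum, ← inner_sum, hE.sum_apply]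
  rw [bell_eq]
  simp only [h₁, h₂]
  simp only [hre]
  exact neg_one_lt_of_commute hφ (hE.projection 1 0) (hE.projection 1 1) (hF.projection 1 0)
    (hF.projection 1 1) (hc _ _ _ _) (hc _ _ _ _) (hc _ _ _ _) (hc _ _ _ _)

theorem neg_one_le_bell_of_mem_closure {P : Box 2 2} (hP : P ∈ closure (quantumSet.{u} 2 2)) :
    -1 ≤ bell P := by
  have hcont : Continuous bell := by
    rw [funext bell_eq]
    fun_prop
  exact closure_minimal (fun Q hQ => (neg_one_lt_bell hQ).le)
    (isClosed_le continuous_const hcont) hP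

theorem explicitBox_notMem_closure_quantumSet : explicitBox ∉ closure (quantumSet.{u} 2 2) := by
  intro h
  have h₁ := neg_one_le_bell_of_mem_closure h
  have h₂ := (abs_lt.1 abs_bell_explicitBox_sub_lt).2
  norm_num at h₂
  linarith

end AlmostQuantum

theorem mainTheorem3 :
    AlmostQuantum.IsNonSignalling AlmostQuantum.explicitBox ∧
    AlmostQuantum.toVector AlmostQuantum.explicitBox = AlmostQuantum.explicitVector ∧
    AlmostQuantum.IsCertificate AlmostQuantum.explicitBox
      (AlmostQuantum.explicitMatrix.submatrix AlmostQuantum.eventIndex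
        AlmostQuantum.eventIndex) ∧
    AlmostQuantum.explicitBox ∈ AlmostQuantum.almostQuantumSet.{u} 2 2 ∧
    |AlmostQuantum.bell AlmostQuantum.explicitBox - (-1.0029)| < 0.00005 ∧
    (∀ P ∈ AlmostQuantum.quantumSet.{u} 2 2, -1 < AlmostQuantum.bell P) ∧
    AlmostQuantum.explicitBox ∉ closure (AlmostQuantum.quantumSet.{u} 2 2) ∧
    AlmostQuantum.quantumSet.{u} 2 2 ⊂ AlmostQuantum.almostQuantumSet.{u} 2 2 ∧
    closure (AlmostQuantum.quantumSet.{u} 2 2) ⊂ AlmostQuantum.almostQuantumSet.{u} 2 2 := by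
  have hmem : AlmostQuantum.explicitBox ∈ AlmostQuantum.almostQuantumSet.{u} 2 2 :=
    AlmostQuantum.isCertificate_explicitMatrix.mem_almostQuantumSet
      AlmostQuantum.isNonSignalling_explicitBox
  have hnot := AlmostQuantum.explicitBox_notMem_closure_quantumSet.{u}
  have hsub := AlmostQuantum.quantumSet_subset_almostQuantumSet.{u} (m := 2) (d := 2)
  have hcl := closure_minimal hsub AlmostQuantum.isClosed_almostQuantumSet
  exact ⟨AlmostQuantum.isNonSignalling_explicitBox, AlmostQuantum.toVector_ofVector _,
    AlmostQuantum.isCertificate_explicitMatrix, hmem, AlmostQuantum.abs_bell_explicitBox_sub_lt,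
    fun P hP => AlmostQuantum.neg_one_lt_bell hP, hnot,
    ⟨hsub, fun h => hnot (subset_closure (h hmem))⟩, ⟨hcl, fun h => hnot (h hmem)⟩⟩
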